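/- Let $\Omega\subset\mathbb R^3$ be a bounded domain with Lipschitz boundary, let $k\ge 0$, and let $G_k(z,x)=\dfrac{e^{ik|z-x|}}{4\pi|z-x|}$ for $z\neq x$. A needle with tip at $x\in\Omega$ is a piecewise linear, injective curve $\sigma:[0,1]\to\overline\Omega$ with $\sigma(0)\in\partial\Omega$, $\sigma(1)=x$ and $\sigma(t)\in\Omega$ for $0<t<1$; its image is also denoted by $\sigma$. A sequence $\{v_n\}$ of complex-valued functions in $H^1(\Omega)$ is a needle sequence for $(x,\sigma)$ if every $v_n$ is a weak solution of $\Delta v+k^2v=0$ in $\Omega$ and $v_n\to G_k(\cdot,x)$ in $H^1_{\mathrm{loc}}(\Omega\setminus\sigma)$, that is, for every compact set $K\subset\Omega\setminus\sigma$, $$\lim_{n\to\infty}\Big(\|v_n-G_k(\cdot,x)\|_{L^2(K)}+\|\nabla(v_n-G_k(\cdot,x))\|_{L^2(K)}\Big)=0.$$ Let $D$ be a nonempty open set with $\overline D\subset\Omega$ of the form $D=\bigcup_{j=1}^N D_j$ with $1\le N<\infty$, where each $D_j$ is a connected component of $D$ with Lipschitz boundary and $\overline{D_j}\cap\overline{D_l}=\emptyset$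 for $j\ne l$. Let $x\in\Omega$, let $\sigma$ be a needle with tip at $x$, and let $\{v_n\}$ be a needle sequence for $(x,\sigma)$ such that $\lim_{n\to\infty}\|\nabla v_n\|_{L^2(D)}=\infty$. Then $$\lim_{n\to\infty}\frac{\|v_n\|_{L^2(D)}}{\|\nabla v_n\|_{L^2(D)}}=0.$$ The same conclusion holds for every sequence $\{v_n\}$ in $H^1(\Omega)$, whether or not its terms solve the Helmholtz equation, such that $v_n\to G_k(\cdot,x)$ in $H^1_{\mathrm{loc}}(\Omega\setminus\sigma)$ and $\lim_{n\to\infty}\|\nabla v_n\|_{L^2(D)}=\infty$. Here an open set $U\subset\mathbb R^3$ has Lipschitz boundary if every point of $\partial U$ lies in an open box $V=\{|y_i|<a_i,\ i=1,2,3\}$ of some orthogonal coordinate system $(y_1,y_2,y_3)$ for which there is a Lipschitz function $\varphi$ with $|\varphi|\le a_3/2$ on the base of $V$, $U\cap V=\{y\in V: y_3<\varphi(y_1,y_2)\}$ and $\partial U\cap V=\{y\in V: y_3=\varphi(y_1,y_2)\}$. -/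

import Mathlib

open Set Filter MeasureTheory
open scoped Topology ContDiff NNReal

/-- The Euclidean space `ℝ³`. -/
abbrev E3 : Type := EuclideanSpace ℝ (Fin 3)

/-- The values of complex gradients: `ℂ³` with its Hermitian norm. -/
abbrev C3 : Type := EuclideanSpace ℂ (Fin 3)

/-- The classical partial derivative `∂ᵢ f (z)`. -/
noncomputable def partialDeriv {F : Type*} [NormedAddCommGroup F] [NormedSpace ℝ F]
    (i : Fin 3) (f : E3 → F) (z : E3) : F :=
  fderiv ℝ f z (EuclideanSpace.single i 1)

/-- `U` has a Lipschitz boundary: near each of its points, in suitable orthogonal coordinates `e`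
and in an open box `V` of these coordinates, `U` is the part of `V` strictly below the graph of a
Lipschitz function of the first two coordinates and the boundary of `U` is that graph. (A Lipschitz
function on the base of the box extends to a Lipschitz function on the plane.) -/
def HasLipschitzBoundary (U : Set E3) : Prop :=
  ∀ p ∈ frontier U, ∃ (e : E3 ≃ᵃⁱ[ℝ] E3) (a : Fin 3 → ℝ)
    (φ : EuclideanSpace ℝ (Fin 2) → ℝ) (L : ℝ≥0) (V : Set E3),
    V = {z | ∀ i, |e z i| < a i} ∧ p ∈ V ∧ LipschitzWith L φ ∧
    (∀ y : EuclideanSpace ℝ (Fin 2), |y 0| < a 0 → |y 1| < a 1 → |φ y| ≤ a 2 / 2) ∧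
    U ∩ V = {z ∈ V | e z 2 < φ !₂[e z 0, e z 1]} ∧
    frontier U ∩ V = {z ∈ V | e z 2 = φ !₂[e z 0, e z 1]}

/-- `σ` is piecewise linear on `[0, 1]`: there is a partition `0 = t₀ < t₁ < ⋯ < tₘ = 1` such that
`σ` is affine on each closed interval `[tᵢ, tᵢ₊₁]` (in particular `σ` is continuous on `[0, 1]`). -/
def IsPiecewiseLinear (σ : ℝ → E3) : Prop :=
  ∃ (m : ℕ) (t : Fin (m + 1) → ℝ), StrictMono t ∧ t 0 = 0 ∧ t (Fin.last m) = 1 ∧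
    ∀ i : Fin m, ∀ s ∈ Icc (0 : ℝ) 1,
      σ (AffineMap.lineMap (t i.castSucc) (t i.succ) s) =
        AffineMap.lineMap (σ (t i.castSucc)) (σ (t i.succ)) s

/-- `σ` (only its restriction to `[0, 1]` matters) is a needle in `Ω` with tip at `x`. -/
structure IsNeedle (Ω : Set E3) (x : E3) (σ : ℝ → E3) : Prop where
  piecewiseLinear : IsPiecewiseLinear σ
  injOn : InjOn σ (Icc 0 1)
  mapsTo : MapsTo σ (Icc 0 1) (closure Ω)
  start_mem : σ 0 ∈ frontier Ω
  tip : σ 1 = x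
  mem : ∀ t ∈ Ioo (0 : ℝ) 1, σ t ∈ Ω

/-- `φ` is a test function on `Ω`: smooth with compact support contained in `Ω`. -/
structure IsTestFunction (Ω : Set E3) (φ : E3 → ℂ) : Prop where
  smooth : ContDiff ℝ ∞ φ
  compact : HasCompactSupport φ
  supp : tsupport φ ⊆ Ω

/-- `u` belongs to the (complex) Sobolev space `H¹(Ω)` and `g` is its weak gradient on `Ω`. -/
structure IsH1WithGrad (Ω : Set E3) (u : E3 → ℂ) (g : E3 → C3) : Prop where
  memLp : MemLp u 2 (volume.restrict Ω)
  memLp_grad : MemLp g 2 (volume.restrict Ω)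
  weak_grad : ∀ φ : E3 → ℂ, IsTestFunction Ω φ → ∀ i : Fin 3,
    ∫ z in Ω, u z * partialDeriv i φ z = - ∫ z in Ω, g z i * φ z

/-- For `u ∈ H¹(Ω)` with weak gradient `g`: the Helmholtz equation `Δu + k²u = 0` in `Ω`, in the
weak sense. -/
def WeakHelmholtz (Ω : Set E3) (k : ℝ) (u : E3 → ℂ) (g : E3 → C3) : Prop :=
  ∀ φ : E3 → ℂ, IsTestFunction Ω φ →
    ∫ z in Ω, ∑ i, g z i * partialDeriv i φ z = (k : ℂ) ^ 2 * ∫ z in Ω, u z * φ z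

/-- `G_k(z, x) = e^{ik|z - x|} / (4π|z - x|)`; only its values at `z ≠ x` matter. -/
noncomputable def helmholtzG (k : ℝ) (x z : E3) : ℂ :=
  Complex.exp (Complex.I * (k * ‖z - x‖ : ℝ)) / ((4 * Real.pi * ‖z - x‖ : ℝ) : ℂ)

/-- The gradient of `z ↦ G_k(z, x)` at `z ≠ x` (where the function is smooth). -/
noncomputable def gradHelmholtzG (k : ℝ) (x z : E3) : C3 :=
  WithLp.toLp 2 fun i => partialDeriv i (helmholtzG k x) z

/-- The norm of `L²(S)`, for functions that belong to `L²(S)`. -/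
noncomputable def l2Norm {F : Type*} [NormedAddCommGroup F] (S : Set E3) (f : E3 → F) : ℝ :=
  (eLpNorm f 2 (volume.restrict S)).toReal

/-- `v n` (with weak gradients `g n`) converges to `G_k(·, x)` in `H¹_loc(Ω ∖ σ)`, that is, in
`H¹(K)` for every compact `K ⊆ Ω ∖ σ`. -/
def ConvergesToG (Ω : Set E3) (k : ℝ) (x : E3) (σ : ℝ → E3)
    (v : ℕ → E3 → ℂ) (g : ℕ → E3 → C3) : Prop :=
  ∀ K : Set E3, IsCompact K → K ⊆ Ω \ σ '' Icc 0 1 →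
    Tendsto (fun n => l2Norm K (fun z => v n z - helmholtzG k x z) +
      l2Norm K (fun z => g n z - gradHelmholtzG k x z)) atTop (𝓝 0)

/-- `v` (with weak gradients `g`) is a needle sequence for `(x, σ)`. -/
structure IsNeedleSequence (Ω : Set E3) (k : ℝ) (x : E3) (σ : ℝ → E3)
    (v : ℕ → E3 → ℂ) (g : ℕ → E3 → C3) : Prop where
  memH1 : ∀ n, IsH1WithGrad Ω (v n) (g n)
  helmholtz : ∀ n, WeakHelmholtz Ω k (v n) (g n)
  converges : ConvergesToG Ω k x σ v g

/-!
The square integrals of functions bounded in `H¹(D)` are uniformly small over sets of small measure,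
because `D` is a finite union of bounded Lipschitz domains, and the needle is a compact null set. Given
`ε > 0`, choose a compact `K ⊆ D ∖ σ` with `D ∖ K` so small that
`‖v‖²_{L²(D ∖ K)} ≤ ε (‖v‖²_{L²(D)} + ‖∇v‖²_{L²(D)})` for all `v ∈ H¹(D)`. On `K` the sequence
converges in `L²` to `G_k(·, x)`, which is continuous there (the pole `x` is the tip of the needle), so
`‖v_n‖_{L²(K)}` stays bounded by some `M`. Hence `‖v_n‖² ≤ M² + ε (‖v_n‖² + ‖∇v_n‖²)` on `D`; absorb
the term with `‖v_n‖²`, divide by `‖∇v_n‖² → ∞`, and let `ε → 0`.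

Uniform integrability (`H1EquiintegrableOn`) follows from translations. Near a point of the closure of a
Lipschitz domain `U` there is a cone of vectors `y` such that the segments from `z` to `z - y` remain in
`U` (`exists_translations_into`). Along such vectors, `‖u - u(· - y)‖_{L²} ≤ |y| ‖∇u‖_{L²}`, obtained
directly for weak gradients by duality with test functions (`ae_sub_translate_eq_integral`,
`lintegral_translate_le`). Averaging over a small open set `B` of such vectors of length at most `R`
gives, for a set `A` near the point,
`∫_A |u|² ≤ 2 (|A| / |B|) ‖u‖² + 2 R² ‖∇u‖²` (`measure_mul_lintegral_le_of_translates`): first take `R`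
small, then `|A|`. Compactness of the closure of `U` makes this uniform.
-/

open scoped ENNReal

/-! ### Translations of functions with a weak derivative -/

lemma integrable_comp_sub_smul {G : E3 → ℂ} (hG : Integrable G) (hGm : StronglyMeasurable G)
    (y : E3) :
    Integrable (fun p : E3 × ℝ => G (p.1 - p.2 • y))
      (volume.prod (volume.restrict (Icc (0 : ℝ) 1))) := by
  have hm : StronglyMeasurable (fun p : E3 × ℝ => G (p.1 - p.2 • y)) :=
    hGm.comp_measurable (by fun_prop)
  rw [integrable_prod_iff' hm.aestronglyMeasurable]
  refine ⟨Eventually.of_forall fun t => hG.comp_sub_right (t • y), ?_⟩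
  have : (fun t : ℝ => ∫ z, ‖G (z - t • y)‖) = fun _ => ∫ z, ‖G z‖ := by
    ext t
    exact integral_sub_right_eq_self (fun z => ‖G z‖) (t • y)
  simp only [this]
  exact integrable_const _

/-- The fundamental theorem of calculus for a function `u` whose weak derivative on `U` in the
direction `y` is `G`. The segments from `z ∈ S` to `z - y` must stay in `U`; then a test function
on `S` translated by `-t • y` is a test function on `U`, and both sides of the identity have the
same integral against every test function on `S`. -/
theorem ae_sub_translate_eq_integral {U S : Set E3} (hS : IsOpen S) {u G : E3 → ℂ}
    (hu : Integrable u) (hG : Integrable G) (hGm : StronglyMeasurable G) (y : E3)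
    (hw : ∀ φ, IsTestFunction U φ → ∫ z, u z * fderiv ℝ φ z y = -∫ z, G z * φ z)
    (hy : ∀ z ∈ S, ∀ t ∈ Icc (0 : ℝ) 1, z - t • y ∈ U) :
    ∀ᵐ z, z ∈ S → u z - u (z - y) = ∫ t in Icc (0 : ℝ) 1, G (z - t • y) := by
  have hGi := integrable_comp_sub_smul hG hGm y
  have hF : Integrable (fun z => ∫ t in Icc (0 : ℝ) 1, G (z - t • y)) :=
    hGi.integral_prod_left
  have huy : Integrable (fun z => u (z - y)) := hu.comp_sub_right y
  suffices h : ∀ᵐ z, z ∈ S → u z - u (z - y) - ∫ t in Icc (0 : ℝ) 1, G (z - t • y) = 0 by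
    filter_upwards [h] with z hz hzS using sub_eq_zero.1 (hz hzS)
  refine hS.ae_eq_zero_of_integral_contDiff_smul_eq_zero
    (((hu.sub huy).sub hF).locallyIntegrable.locallyIntegrableOn S) ?_
  intro r hr hrc hrS
  set φ : E3 → ℂ := fun z => (r z : ℂ)
  have hφd : ContDiff ℝ ∞ φ := Complex.ofRealCLM.contDiff.comp hr
  have hφc : HasCompactSupport φ := hrc.comp_left (g := Complex.ofReal) Complex.ofReal_zero
  have hφS : tsupport φ ⊆ S :=
    (closure_mono (Function.support_comp_subset (g := Complex.ofReal)
      Complex.ofReal_zero r)).trans hrS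
  have hφcont : Continuous φ := hφd.continuous
  have hφ'cont : Continuous (fun z => fderiv ℝ φ z y) :=
    (hφd.continuous_fderiv (by simp)).clm_apply continuous_const
  obtain ⟨C, hC⟩ := hφc.exists_bound_of_continuous hφcont
  obtain ⟨C', hC'⟩ := (hφc.fderiv_apply (𝕜 := ℝ) y).exists_bound_of_continuous hφ'cont
  -- the weak derivative tested against the translates of `φ`
  have hweak : ∀ t ∈ Icc (0 : ℝ) 1, ∫ z, u z * fderiv ℝ φ (z + t • y) y
      = -∫ z, G (z - t • y) * φ z := by
    intro t ht
    have htest : IsTestFunction U (fun z => φ (z + t • y)) := by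
      refine ⟨hφd.comp (contDiff_id.add contDiff_const),
        hφc.comp_homeomorph (Homeomorph.addRight (t • y)), fun z hz => ?_⟩
      have h1 : z + t • y ∈ S := hφS (tsupport_comp_subset_preimage φ
        (f := fun z => z + t • y) (by fun_prop) hz)
      simpa using hy _ h1 t ht
    have h := hw _ htest
    simp only [fderiv_comp_add_right] at h
    rw [h, ← integral_sub_right_eq_self (fun z => G z * φ (z + t • y)) (t • y)]
    simp
  have hFTC : ∀ z, φ (z + y) - φ z = ∫ t in Icc (0 : ℝ) 1, fderiv ℝ φ (z + t • y) y := by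
    intro z
    have hd : ∀ t ∈ uIcc (0 : ℝ) 1, HasDerivAt (fun t : ℝ => φ (z + t • y))
        (fderiv ℝ φ (z + t • y) y) t := by
      intro t _
      have h1 : HasDerivAt (fun t : ℝ => z + t • y) y t := by
        simpa using ((hasDerivAt_id t).smul_const y).const_add z
      exact ((hφd.differentiable (by simp)) _).hasFDerivAt.comp_hasDerivAt t h1
    have h := intervalIntegral.integral_eq_sub_of_hasDerivAt hd
      ((hφ'cont.comp (by fun_prop : Continuous fun t : ℝ => z + t • y)).intervalIntegrable 0 1)
    rw [intervalIntegral.integral_of_le zero_le_one, ← integral_Icc_eq_integral_Ioc] at h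
    simpa using h.symm
  have hint1 : Integrable (fun p : E3 × ℝ => u p.1 * fderiv ℝ φ (p.1 + p.2 • y) y)
      (volume.prod (volume.restrict (Icc (0 : ℝ) 1))) :=
    (hu.comp_fst _).mul_bdd (c := C')
      (hφ'cont.comp (by fun_prop : Continuous fun p : E3 × ℝ =>
        p.1 + p.2 • y)).aestronglyMeasurable (Eventually.of_forall fun p => hC' _)
  have hint2 : Integrable (fun p : E3 × ℝ => G (p.1 - p.2 • y) * φ p.1)
      (volume.prod (volume.restrict (Icc (0 : ℝ) 1))) :=
    hGi.mul_bdd (c := C) (hφcont.comp continuous_fst).aestronglyMeasurable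
      (Eventually.of_forall fun p => hC _)
  have hbdd : ∀ {f : E3 → ℂ}, Integrable f → Integrable fun z => f z * φ z := fun hf =>
    hf.mul_bdd (c := C) hφcont.aestronglyMeasurable (Eventually.of_forall hC)
  have hshift : ∫ z, u (z - y) * φ z = ∫ z, u z * φ (z + y) := by
    rw [← integral_sub_right_eq_self (fun z => u z * φ (z + y)) y]
    simp
  have hshiftint : Integrable fun z => u z * φ (z + y) :=
    hu.mul_bdd (c := C) (hφcont.comp (by fun_prop)).aestronglyMeasurable
      (Eventually.of_forall fun z => hC _)
  have hmain : ∫ z, (u z - u (z - y)) * φ z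
      = ∫ z, (∫ t in Icc (0 : ℝ) 1, G (z - t • y)) * φ z := by
    calc ∫ z, (u z - u (z - y)) * φ z
        = -∫ z, ∫ t in Icc (0 : ℝ) 1, u z * fderiv ℝ φ (z + t • y) y := by
          simp_rw [sub_mul, integral_const_mul, ← hFTC, mul_sub]
          rw [integral_sub (hbdd hu) (hbdd huy), integral_sub hshiftint (hbdd hu), hshift]
          ring
      _ = -∫ t in Icc (0 : ℝ) 1, ∫ z, u z * fderiv ℝ φ (z + t • y) y := by
          rw [integral_integral_swap hint1]
      _ = ∫ t in Icc (0 : ℝ) 1, ∫ z, G (z - t • y) * φ z := by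
          rw [setIntegral_congr_fun measurableSet_Icc hweak, integral_neg, neg_neg]
      _ = _ := by
          rw [← integral_integral_swap hint2]
          simp_rw [integral_mul_const]
  calc ∫ z, r z • (u z - u (z - y) - ∫ t in Icc (0 : ℝ) 1, G (z - t • y))
      = ∫ z, ((u z - u (z - y)) * φ z - (∫ t in Icc (0 : ℝ) 1, G (z - t • y)) * φ z) := by
        congr 1 with z
        rw [Complex.real_smul]
        ring
    _ = 0 := by
        rw [integral_sub (hbdd (f := fun z => u z - u (z - y)) (hu.sub huy)) (hbdd hF), hmain,
          sub_self]

/-- The `L²` modulus of continuity: the Cauchy–Schwarz inequality on each segment, then Tonelli. -/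
theorem lintegral_translate_le {U S : Set E3} (hS : IsOpen S) {u G : E3 → ℂ}
    (hu : Integrable u) (hG : Integrable G) (hGm : StronglyMeasurable G) (y : E3)
    (hw : ∀ φ, IsTestFunction U φ → ∫ z, u z * fderiv ℝ φ z y = -∫ z, G z * φ z)
    (hy : ∀ z ∈ S, ∀ t ∈ Icc (0 : ℝ) 1, z - t • y ∈ U) :
    ∫⁻ z in S, ‖u z - u (z - y)‖ₑ ^ 2 ≤ ∫⁻ z, ‖G z‖ₑ ^ 2 := by
  have hm : Measurable (fun p : E3 × ℝ => ‖G (p.1 - p.2 • y)‖ₑ ^ 2) :=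
    ((hGm.comp_measurable (by fun_prop : Measurable fun p : E3 × ℝ =>
      p.1 - p.2 • y)).enorm).pow_const 2
  calc ∫⁻ z in S, ‖u z - u (z - y)‖ₑ ^ 2
      ≤ ∫⁻ z in S, ∫⁻ t in Icc (0 : ℝ) 1, ‖G (z - t • y)‖ₑ ^ 2 := by
        refine lintegral_mono_ae ((ae_restrict_iff' hS.measurableSet).2 ?_)
        filter_upwards [ae_sub_translate_eq_integral hS hu hG hGm y hw hy] with z hz hzS
        rw [hz hzS]
        have hGz : AEStronglyMeasurable (fun t : ℝ => G (z - t • y))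
            (volume.restrict (Icc (0 : ℝ) 1)) :=
          (hGm.comp_measurable (by fun_prop)).aestronglyMeasurable
        have h1 := eLpNorm_le_eLpNorm_mul_rpow_measure_univ
          (μ := volume.restrict (Icc (0 : ℝ) 1)) (p := 1) (q := 2) (by norm_num) hGz
        simp only [Measure.restrict_apply_univ, Real.volume_Icc, sub_zero, ENNReal.ofReal_one,
          ENNReal.one_rpow, mul_one, eLpNorm_one_eq_lintegral_enorm] at h1
        have h2 := eLpNorm_nnreal_pow_eq_lintegral (f := fun t : ℝ => G (z - t • y))
          (μ := volume.restrict (Icc (0 : ℝ) 1)) (p := 2) (by norm_num)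
        simp only [NNReal.coe_ofNat, ENNReal.rpow_ofNat, ENNReal.coe_ofNat] at h2
        rw [← h2]
        gcongr
        exact (enorm_integral_le_lintegral_enorm _).trans h1
    _ ≤ ∫⁻ z, ∫⁻ t in Icc (0 : ℝ) 1, ‖G (z - t • y)‖ₑ ^ 2 := setLIntegral_le_lintegral _ _
    _ = ∫⁻ t in Icc (0 : ℝ) 1, ∫⁻ z, ‖G (z - t • y)‖ₑ ^ 2 :=
        lintegral_lintegral_swap hm.aemeasurable
    _ = ∫⁻ z, ‖G z‖ₑ ^ 2 := by
        simp [lintegral_sub_right_eq_self (fun z => ‖G z‖ₑ ^ 2)]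

/-! ### Averaging over small translations -/

lemma fderiv_apply_eq_sum_partialDeriv (φ : E3 → ℂ) (z y : E3) :
    fderiv ℝ φ z y = ∑ i, (y i : ℂ) * partialDeriv i φ z := by
  have h : y = ∑ i, y i • (EuclideanSpace.single i 1 : E3) := by
    ext j
    simp [Finset.sum_apply, Pi.single_apply]
  conv_lhs => rw [h]
  simp [partialDeriv, map_sum]

lemma enorm_sum_mul_le (y : E3) (w : C3) : ‖∑ i, (y i : ℂ) * w i‖ₑ ≤ ‖y‖ₑ * ‖w‖ₑ := by
  have h := norm_inner_le_norm (𝕜 := ℂ) (WithLp.toLp 2 fun i => (y i : ℂ) : C3) w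
  have h1 : ‖(WithLp.toLp 2 fun i => (y i : ℂ) : C3)‖ = ‖y‖ := by
    simp [EuclideanSpace.norm_eq]
  have h2 : inner ℂ (WithLp.toLp 2 fun i => (y i : ℂ) : C3) w = ∑ i, (y i : ℂ) * w i := by
    simp [PiLp.inner_apply, mul_comm]
  rw [h1, h2] at h
  rw [← ofReal_norm, ← ofReal_norm, ← ofReal_norm, ← ENNReal.ofReal_mul (norm_nonneg _)]
  exact ENNReal.ofReal_le_ofReal h

/-- The quantitative source of equi-integrability. For `y ∈ B`, `|u(z)|²` is at most
`2|u(z - y)|² + 2|u(z) - u(z - y)|²`. Integrated over `z ∈ A` and `y ∈ B`, the second term is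
controlled by `R²` times the gradient, and the first, integrated over `y` first, by `|A|` times
the square of the norm of `u`. Division by `|B|` is left to the user. -/
theorem measure_mul_lintegral_le_of_translates {U S A B : Set E3} (hS : IsOpen S) {u : E3 → ℂ}
    {g : E3 → C3} (hu : Integrable u) (hum : StronglyMeasurable u) (hg : Integrable g)
    (hgm : StronglyMeasurable g)
    (hw : ∀ φ, IsTestFunction U φ → ∀ i,
      ∫ z, u z * partialDeriv i φ z = -∫ z, g z i * φ z)
    (hAS : A ⊆ S) {R : ℝ≥0∞} (hB : MeasurableSet B) (hBR : ∀ y ∈ B, ‖y‖ₑ ≤ R)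
    (hBU : ∀ y ∈ B, ∀ z ∈ S, ∀ t ∈ Icc (0 : ℝ) 1, z - t • y ∈ U) :
    volume B * ∫⁻ z in A, ‖u z‖ₑ ^ 2 ≤
      2 * volume A * (∫⁻ z, ‖u z‖ₑ ^ 2) + volume B * (2 * R ^ 2 * ∫⁻ z, ‖g z‖ₑ ^ 2) := by
  have hgi : ∀ i, Integrable fun z => g z i := fun i =>
    (EuclideanSpace.proj (𝕜 := ℂ) i : C3 →L[ℂ] ℂ).integrable_comp hg
  have hgmi : ∀ i, StronglyMeasurable fun z => g z i := fun i =>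
    (EuclideanSpace.proj (𝕜 := ℂ) i : C3 →L[ℂ] ℂ).continuous.comp_stronglyMeasurable hgm
  -- the `L²` modulus of continuity along an admissible translation
  have htrans : ∀ y ∈ B,
      ∫⁻ z in S, ‖u z - u (z - y)‖ₑ ^ 2 ≤ R ^ 2 * ∫⁻ z, ‖g z‖ₑ ^ 2 := by
    intro y hy
    refine (lintegral_translate_le (G := fun z => ∑ i, (y i : ℂ) * g z i) hS hu
      (integrable_finsetSum _ fun i _ => (hgi i).const_mul _)
      (Finset.stronglyMeasurable_fun_sum _ fun i _ => (hgmi i).const_mul _) y ?_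
      (hBU y hy)).trans ?_
    · intro φ hφ
      have hφc := hφ.smooth.continuous
      obtain ⟨C, hC⟩ := hφ.compact.exists_bound_of_continuous hφc
      have hpc : ∀ i, Continuous fun z => partialDeriv i φ z := fun i =>
        (hφ.smooth.continuous_fderiv (by simp)).clm_apply continuous_const
      have h1 : ∀ i, Integrable fun z => u z * partialDeriv i φ z := fun i => by
        obtain ⟨C', hC'⟩ := (hφ.compact.fderiv_apply (𝕜 := ℝ)
          (EuclideanSpace.single i 1)).exists_bound_of_continuous (hpc i)
        exact hu.mul_bdd (c := C') (hpc i).aestronglyMeasurable (Eventually.of_forall hC')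
      have h2 : ∀ i, Integrable fun z => g z i * φ z := fun i =>
        (hgi i).mul_bdd (c := C) hφc.aestronglyMeasurable (Eventually.of_forall hC)
      calc ∫ z, u z * fderiv ℝ φ z y
          = ∫ z, ∑ i, (y i : ℂ) * (u z * partialDeriv i φ z) := by
            congr 1 with z
            rw [fderiv_apply_eq_sum_partialDeriv, Finset.mul_sum]
            exact Finset.sum_congr rfl fun i _ => by ring
        _ = ∑ i, (y i : ℂ) * ∫ z, u z * partialDeriv i φ z := by
            rw [integral_finsetSum _ fun i _ => (h1 i).const_mul _]
            simp_rw [integral_const_mul]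
        _ = -∑ i, (y i : ℂ) * ∫ z, g z i * φ z := by
            simp_rw [hw φ hφ, mul_neg, Finset.sum_neg_distrib]
        _ = -∫ z, ∑ i, (y i : ℂ) * (g z i * φ z) := by
            rw [integral_finsetSum _ fun i _ => (h2 i).const_mul _]
            simp_rw [integral_const_mul]
        _ = -∫ z, (∑ i, (y i : ℂ) * g z i) * φ z := by
            congr 2 with z
            rw [Finset.sum_mul]
            exact Finset.sum_congr rfl fun i _ => by ring
    · rw [← lintegral_const_mul _ (hgm.enorm.pow_const 2)]
      refine lintegral_mono fun z => ?_
      rw [← mul_pow]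
      gcongr
      exact (enorm_sum_mul_le y (g z)).trans (by gcongr; exact hBR y hy)
  have hum2 : Measurable fun p : E3 × E3 => ‖u (p.2 - p.1)‖ₑ ^ 2 :=
    (hum.comp_measurable (by fun_prop : Measurable fun p : E3 × E3 => p.2 - p.1)).enorm.pow_const 2
  -- `|u(z)|² ≤ 2|u(z - y)|² + 2|u(z) - u(z - y)|²`, integrated over `A` for fixed `y`
  have hpoint : ∀ y ∈ B, ∫⁻ z in A, ‖u z‖ₑ ^ 2 ≤
      2 * (∫⁻ z in A, ‖u (z - y)‖ₑ ^ 2) + 2 * (R ^ 2 * ∫⁻ z, ‖g z‖ₑ ^ 2) := by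
    intro y hy
    have hmy : Measurable fun z => ‖u (z - y)‖ₑ ^ 2 :=
      (hum.comp_measurable (by fun_prop : Measurable fun z : E3 => z - y)).enorm.pow_const 2
    calc ∫⁻ z in A, ‖u z‖ₑ ^ 2
        ≤ ∫⁻ z in A, (2 * ‖u (z - y)‖ₑ ^ 2 + 2 * ‖u z - u (z - y)‖ₑ ^ 2) := by
          refine lintegral_mono fun z => ?_
          have h1 : ‖u z‖ₑ ≤ ‖u (z - y)‖ₑ + ‖u z - u (z - y)‖ₑ := by
            simpa using enorm_add_le (u (z - y)) (u z - u (z - y))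
          have h2 := ENNReal.rpow_add_le_mul_rpow_add_rpow ‖u (z - y)‖ₑ ‖u z - u (z - y)‖ₑ
            (p := 2) (by norm_num)
          norm_num at h2
          rw [← mul_add]
          exact (by gcongr : ‖u z‖ₑ ^ 2 ≤ _ ^ 2).trans h2
      _ = 2 * (∫⁻ z in A, ‖u (z - y)‖ₑ ^ 2) + 2 * ∫⁻ z in A, ‖u z - u (z - y)‖ₑ ^ 2 := by
          rw [lintegral_add_left (hmy.const_mul 2), lintegral_const_mul _ hmy,
            lintegral_const_mul' _ _ (by norm_num)]
      _ ≤ _ := by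
          gcongr
          exact (lintegral_mono_set hAS).trans (htrans y hy)
  calc volume B * ∫⁻ z in A, ‖u z‖ₑ ^ 2
      = ∫⁻ _ in B, ∫⁻ z in A, ‖u z‖ₑ ^ 2 := by rw [setLIntegral_const, mul_comm]
    _ ≤ ∫⁻ y in B, (2 * (∫⁻ z in A, ‖u (z - y)‖ₑ ^ 2) + 2 * (R ^ 2 * ∫⁻ z, ‖g z‖ₑ ^ 2)) :=
        setLIntegral_mono' hB hpoint
    _ = 2 * (∫⁻ y in B, ∫⁻ z in A, ‖u (z - y)‖ₑ ^ 2)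
          + volume B * (2 * R ^ 2 * ∫⁻ z, ‖g z‖ₑ ^ 2) := by
        rw [lintegral_add_right _ measurable_const, lintegral_const_mul' _ _ (by norm_num),
          setLIntegral_const]
        ring
    _ = 2 * (∫⁻ z in A, ∫⁻ y in B, ‖u (z - y)‖ₑ ^ 2)
          + volume B * (2 * R ^ 2 * ∫⁻ z, ‖g z‖ₑ ^ 2) := by
        rw [lintegral_lintegral_swap hum2.aemeasurable]
    _ ≤ 2 * (∫⁻ _ in A, ∫⁻ y, ‖u y‖ₑ ^ 2)
          + volume B * (2 * R ^ 2 * ∫⁻ z, ‖g z‖ₑ ^ 2) := by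
        refine add_le_add_left (mul_le_mul_right (lintegral_mono fun z => ?_) _) _
        exact (setLIntegral_le_lintegral _ _).trans
          (lintegral_sub_left_eq_self (μ := volume) (fun y => ‖u y‖ₑ ^ 2) z).le
    _ = _ := by
        rw [setLIntegral_const]
        ring

/-! ### Restriction and extension by zero -/

theorem IsH1WithGrad.mono {Ω D : Set E3} {u : E3 → ℂ} {g : E3 → C3} (h : IsH1WithGrad Ω u g)
    (hD : D ⊆ Ω) : IsH1WithGrad D u g := by
  have key : ∀ φ f : E3 → ℂ, (∀ z ∉ tsupport φ, f z = 0) → tsupport φ ⊆ D →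
      ∫ z in Ω, f z = ∫ z in D, f z := fun φ f hf hφ => by
    rw [setIntegral_eq_integral_of_forall_compl_eq_zero fun z hz =>
        hf z fun hz' => hz (hD (hφ hz')),
      setIntegral_eq_integral_of_forall_compl_eq_zero fun z hz =>
        hf z fun hz' => hz (hφ hz')]
  refine ⟨h.memLp.mono_measure (Measure.restrict_mono_set _ hD),
    h.memLp_grad.mono_measure (Measure.restrict_mono_set _ hD), fun φ hφ i => ?_⟩
  have h1 := h.weak_grad φ ⟨hφ.smooth, hφ.compact, hφ.supp.trans hD⟩ i
  rwa [key φ _ (fun z hz => ?_) hφ.supp, key φ _ (fun z hz => ?_) hφ.supp] at h1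
  · rw [image_eq_zero_of_notMem_tsupport hz, mul_zero]
  · rw [partialDeriv, fderiv_of_notMem_tsupport (𝕜 := ℝ) hz]
    simp

/-- Extension by zero of measurable representatives of `u` and `g`. The weak gradient identity is
kept only for test functions on `U`: the extension need not be in `H¹(ℝ³)`. -/
theorem IsH1WithGrad.exists_global {U : Set E3} (hU : MeasurableSet U) (hfin : volume U ≠ ⊤)
    {u : E3 → ℂ} {g : E3 → C3} (h : IsH1WithGrad U u g) :
    ∃ (u' : E3 → ℂ) (g' : E3 → C3), Integrable u' ∧ StronglyMeasurable u' ∧ Integrable g' ∧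
      StronglyMeasurable g' ∧ u' =ᵐ[volume.restrict U] u ∧
      (∀ φ, IsTestFunction U φ → ∀ i,
        ∫ z, u' z * partialDeriv i φ z = -∫ z, g' z i * φ z) ∧
      ∫⁻ z, ‖u' z‖ₑ ^ 2 = ∫⁻ z in U, ‖u z‖ₑ ^ 2 ∧
      ∫⁻ z, ‖g' z‖ₑ ^ 2 = ∫⁻ z in U, ‖g z‖ₑ ^ 2 := by
  have : IsFiniteMeasure (volume.restrict U) := ⟨by simpa using hfin.lt_top⟩
  have ind : ∀ {F : Type} [NormedAddCommGroup F] (f : E3 → F),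
      MemLp f 2 (volume.restrict U) → ∃ f' : E3 → F, Integrable f' ∧ StronglyMeasurable f' ∧
        f' =ᵐ[volume.restrict U] f ∧ (∀ z ∉ U, f' z = 0) ∧
        ∫⁻ z, ‖f' z‖ₑ ^ 2 = ∫⁻ z in U, ‖f z‖ₑ ^ 2 := by
    intro F _ f hf
    have hae : U.indicator (hf.1.mk f) =ᵐ[volume.restrict U] f :=
      (indicator_ae_eq_restrict hU).trans hf.1.ae_eq_mk.symm
    refine ⟨U.indicator (hf.1.mk f), ?_, hf.1.stronglyMeasurable_mk.indicator hU, hae,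
      fun z hz => indicator_of_notMem hz _, ?_⟩
    · rw [integrable_indicator_iff hU]
      exact (hf.integrable (by norm_num)).congr hf.1.ae_eq_mk
    · have h1 : ∫⁻ z in U, ‖f z‖ₑ ^ 2 = ∫⁻ z in U, ‖U.indicator (hf.1.mk f) z‖ₑ ^ 2 :=
        lintegral_congr_ae (hae.mono fun z hz => by simp only [hz])
      rw [h1, ← lintegral_indicator hU]
      refine lintegral_congr fun z => ?_
      by_cases hz : z ∈ U <;> simp [hz]
  obtain ⟨u', hu1, hu2, hu3, hu4, hu5⟩ := ind u h.memLp
  obtain ⟨g', hg1, hg2, hg3, hg4, hg5⟩ := ind g h.memLp_grad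
  refine ⟨u', g', hu1, hu2, hg1, hg2, hu3, fun φ hφ i => ?_, hu5, hg5⟩
  calc ∫ z, u' z * partialDeriv i φ z
      = ∫ z in U, u' z * partialDeriv i φ z :=
        (setIntegral_eq_integral_of_forall_compl_eq_zero fun z hz => by
          rw [hu4 z hz, zero_mul]).symm
    _ = ∫ z in U, u z * partialDeriv i φ z :=
        integral_congr_ae (hu3.mono fun z hz => by simp only [hz])
    _ = -∫ z in U, g z i * φ z := h.weak_grad φ hφ i
    _ = -∫ z in U, g' z i * φ z := by
        have h1 : ∫ z in U, g' z i * φ z = ∫ z in U, g z i * φ z :=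
          integral_congr_ae (hg3.mono fun z hz => by simp only [hz])
        rw [h1]
    _ = -∫ z, g' z i * φ z := by
        rw [setIntegral_eq_integral_of_forall_compl_eq_zero fun z hz => by
          rw [hg4 z hz, PiLp.zero_apply, zero_mul]]

/-! ### Small translations into a Lipschitz domain -/

/-- The interior cone property of a Lipschitz domain `U`: near each point of the closure, arbitrarily
small open sets of vectors `y` have the property that the segment from a point `z` of `U` to
`z - y` stays in `U`. -/
theorem exists_translations_into {U : Set E3} (hU : IsOpen U) (hL : HasLipschitzBoundary U)
    {p : E3} (hp : p ∈ closure U) :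
    ∃ W : Set E3, IsOpen W ∧ p ∈ W ∧ ∀ h : ℝ, 0 < h → ∃ B : Set E3, IsOpen B ∧ B.Nonempty ∧
      (∀ y ∈ B, ‖y‖ ≤ h) ∧
      ∀ y ∈ B, ∀ z ∈ U ∩ W, ∀ t ∈ Icc (0 : ℝ) 1, z - t • y ∈ U := by
  have hball : ∀ {r : ℝ} {z y : E3} {t : ℝ}, z ∈ Metric.ball p (r / 2) → ‖y‖ < r / 2 →
      t ∈ Icc (0 : ℝ) 1 → z - t • y ∈ Metric.ball p r := by
    intro r z y t hz hy ht
    rw [mem_ball_iff_norm] at hz ⊢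
    have h1 : ‖t • y‖ ≤ ‖y‖ := by
      rw [norm_smul, Real.norm_of_nonneg ht.1]
      exact mul_le_of_le_one_left (norm_nonneg _) ht.2
    have h2 := norm_sub_le (z - p) (t • y)
    rw [show z - t • y - p = z - p - t • y by abel]
    linarith
  by_cases hpU : p ∈ U
  · obtain ⟨r, hr, hrU⟩ := Metric.isOpen_iff.1 hU p hpU
    refine ⟨Metric.ball p (r / 2), Metric.isOpen_ball, Metric.mem_ball_self (by positivity),
      fun h hh => ⟨Metric.ball 0 (min h (r / 2)), Metric.isOpen_ball,
        ⟨0, Metric.mem_ball_self (by positivity)⟩, fun y hy => ?_, fun y hy z hz t ht => ?_⟩⟩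
    · rw [mem_ball_zero_iff, lt_min_iff] at hy
      exact hy.1.le
    · rw [mem_ball_zero_iff, lt_min_iff] at hy
      exact hrU (hball hz.2 hy.2 ht)
  · have hpf : p ∈ frontier U := by
      rw [hU.frontier_eq]
      exact ⟨hp, hpU⟩
    obtain ⟨e, a, φ, L, V, hV, hpV, hφ, -, hUV, -⟩ := hL p hpf
    have hVo : IsOpen V := by
      rw [hV, ofPred_forall]
      refine isOpen_iInter_of_finite fun i => isOpen_lt ?_ continuous_const
      exact ((EuclideanSpace.proj (𝕜 := ℝ) i : E3 →L[ℝ] ℝ).continuous.comp e.continuous).abs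
    obtain ⟨r, hr, hrV⟩ := Metric.isOpen_iff.1 hVo p hpV
    refine ⟨Metric.ball p (r / 2), Metric.isOpen_ball, Metric.mem_ball_self (by positivity),
      fun h hh => ?_⟩
    -- In the coordinates `e` the translations fill a ball of radius `ρ` about the vertical vector
    -- of length `c`. Since `L * ρ ≤ c - ρ`, going down by at least `c - ρ` while moving sideways by
    -- at most `ρ` keeps a point below the graph of the `L`-Lipschitz function `φ`.
    set c : ℝ := min h (r / 2) / 2 with hc
    have hc0 : 0 < c := by positivity
    set ρ : ℝ := c / (2 * (L + 1)) with hρ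
    have hρ0 : 0 < ρ := by positivity
    have hρc : (L + 1) * ρ = c / 2 := by
      rw [hρ]
      field_simp
    have hLρ : 0 ≤ L * ρ := by positivity
    set b : E3 := EuclideanSpace.single 2 c with hb
    have hbn : ‖b‖ = c := by simp [hb, abs_of_pos hc0]
    set ψ := e.linearIsometryEquiv
    have hnorm : ∀ y ∈ Metric.ball (ψ.symm b) ρ, ‖ψ y - b‖ < ρ := fun y hy => by
      rw [mem_ball_iff_norm] at hy
      rwa [← ψ.symm.norm_map, map_sub, ψ.symm_apply_apply]
    have hsmall : ∀ y ∈ Metric.ball (ψ.symm b) ρ, ‖y‖ < min h (r / 2) := fun y hy => by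
      have h1 := norm_add_le (ψ y - b) b
      rw [sub_add_cancel, ψ.norm_map, hbn] at h1
      have h2 := hnorm y hy
      have h3 : min h (r / 2) = 2 * c := by rw [hc]; ring
      rw [h3]
      linarith
    refine ⟨Metric.ball (ψ.symm b) ρ, Metric.isOpen_ball, ⟨_, Metric.mem_ball_self hρ0⟩,
      fun y hy => ((hsmall y hy).trans_le (min_le_left _ _)).le, fun y hy z hz t ht => ?_⟩
    have hzV : z ∈ V := hrV (Metric.ball_subset_ball (by linarith) hz.2)
    have hwV : z - t • y ∈ V :=
      hrV (hball hz.2 ((hsmall y hy).trans_le (min_le_right _ _)) ht)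
    have hz' : e z 2 < φ !₂[e z 0, e z 1] := by
      have : z ∈ U ∩ V := ⟨hz.1, hzV⟩
      rw [hUV] at this
      exact this.2
    have hmap : e (z - t • y) = e z - t • ψ y := by
      have := e.map_vadd z (-(t • y))
      simp only [vadd_eq_add, map_neg, map_smul] at this
      rw [sub_eq_add_neg, add_comm, this]
      abel
    have hlip : φ !₂[e z 0, e z 1] - φ !₂[e (z - t • y) 0, e (z - t • y) 1] ≤ L * (t * ρ) := by
      refine (le_abs_self _).trans ((hφ.dist_le_mul _ _).trans ?_)
      gcongr
      have h1 : !₂[e z 0, e z 1] - !₂[e (z - t • y) 0, e (z - t • y) 1]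
          = t • !₂[(ψ y - b) 0, (ψ y - b) 1] := by
        ext i
        fin_cases i <;> simp [hmap, hb]
      rw [dist_eq_norm, h1, norm_smul, Real.norm_of_nonneg ht.1]
      have h2 : ‖!₂[(ψ y - b) 0, (ψ y - b) 1]‖ ≤ ‖ψ y - b‖ := by
        rw [EuclideanSpace.norm_eq, EuclideanSpace.norm_eq]
        refine Real.sqrt_le_sqrt ?_
        rw [Fin.sum_univ_two, Fin.sum_univ_three]
        simp only [Matrix.cons_val_zero, Matrix.cons_val_one]
        exact le_add_of_nonneg_right (sq_nonneg _)
      exact mul_le_mul_of_nonneg_left (h2.trans (hnorm y hy).le) ht.1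
    have h2 : c - ρ ≤ ψ y 2 := by
      have h3 := (PiLp.norm_apply_le (ψ y - b) 2).trans (hnorm y hy).le
      rw [Real.norm_eq_abs, abs_le] at h3
      have : (ψ y - b) 2 = ψ y 2 - c := by simp [hb]
      linarith [h3.1]
    have hmem : z - t • y ∈ U ∩ V := by
      rw [hUV]
      refine ⟨hwV, ?_⟩
      have h3 : e (z - t • y) 2 = e z 2 - t * ψ y 2 := by simp [hmap]
      rw [h3]
      have h4 : t * (L * ρ) ≤ t * ψ y 2 := mul_le_mul_of_nonneg_left (by linarith) ht.1
      linarith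
    exact hmem.1

/-! ### Equi-integrability of bounded sets of `H¹` -/

/-- The squares of the functions in the unit ball of `H¹(D)` are uniformly integrable on `s`: their
integrals over subsets of `s` of small measure are small. The sets `A` and `s` are not required to be
measurable, which makes the property stable under unions without further hypotheses. -/
def H1EquiintegrableOn (D s : Set E3) : Prop :=
  ∀ ε : ℝ≥0∞, ε ≠ 0 → ∃ δ : ℝ≥0∞, δ ≠ 0 ∧ ∀ (u : E3 → ℂ) (g : E3 → C3), IsH1WithGrad D u g →
    ∀ A ⊆ s, volume A ≤ δ →
      ∫⁻ z in A, ‖u z‖ₑ ^ 2 ≤ ε * ((∫⁻ z in D, ‖u z‖ₑ ^ 2) + ∫⁻ z in D, ‖g z‖ₑ ^ 2)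

theorem H1EquiintegrableOn.empty (D : Set E3) : H1EquiintegrableOn D ∅ := fun _ _ =>
  ⟨1, one_ne_zero, fun u g _ A hA _ => by simp [subset_empty_iff.1 hA]⟩

theorem H1EquiintegrableOn.mono {D s t : Set E3} (hst : s ⊆ t) (ht : H1EquiintegrableOn D t) :
    H1EquiintegrableOn D s := fun ε hε =>
  let ⟨δ, hδ, h⟩ := ht ε hε
  ⟨δ, hδ, fun u g hu A hA => h u g hu A (hA.trans hst)⟩

theorem H1EquiintegrableOn.union {D s t : Set E3} (hs : H1EquiintegrableOn D s)
    (ht : H1EquiintegrableOn D t) : H1EquiintegrableOn D (s ∪ t) := by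
  intro ε hε
  obtain ⟨δ₁, hδ₁, h₁⟩ := hs (ε / 2) (by simpa using hε)
  obtain ⟨δ₂, hδ₂, h₂⟩ := ht (ε / 2) (by simpa using hε)
  refine ⟨min δ₁ δ₂, by simp [min_eq_iff, hδ₁, hδ₂], fun u g hu A hA hAδ => ?_⟩
  rw [le_min_iff] at hAδ
  have hA' : A = (A ∩ s) ∪ (A ∩ t) := by rw [← inter_union_distrib_left, inter_eq_left.2 hA]
  calc ∫⁻ z in A, ‖u z‖ₑ ^ 2
      ≤ (∫⁻ z in A ∩ s, ‖u z‖ₑ ^ 2) + ∫⁻ z in A ∩ t, ‖u z‖ₑ ^ 2 := by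
        conv_lhs => rw [hA']
        exact lintegral_union_le _ _ _
    _ ≤ ε / 2 * ((∫⁻ z in D, ‖u z‖ₑ ^ 2) + ∫⁻ z in D, ‖g z‖ₑ ^ 2)
        + ε / 2 * ((∫⁻ z in D, ‖u z‖ₑ ^ 2) + ∫⁻ z in D, ‖g z‖ₑ ^ 2) :=
        add_le_add
          (h₁ u g hu _ inter_subset_right ((measure_mono inter_subset_left).trans hAδ.1))
          (h₂ u g hu _ inter_subset_right ((measure_mono inter_subset_left).trans hAδ.2))
    _ = _ := by rw [← add_mul, ENNReal.add_halves]

/-- The local form of equi-integrability: with `R = √(c / 2)` the gradient term of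
`measure_mul_lintegral_le_of_translates` has the factor `2 * R ^ 2 = c ≤ ε`, and the other term is
small once `2 * volume A ≤ ε * volume B`. -/
theorem exists_H1EquiintegrableOn_inter_nhds {D U : Set E3} (hD : IsOpen D)
    (hfin : volume D ≠ ⊤) (hU : IsOpen U) (hUD : U ⊆ D) (hL : HasLipschitzBoundary U) {p : E3}
    (hp : p ∈ closure U) : ∃ W : Set E3, IsOpen W ∧ p ∈ W ∧ H1EquiintegrableOn D (U ∩ W) := by
  obtain ⟨W, hWo, hpW, hW⟩ := exists_translations_into hU hL hp
  refine ⟨W, hWo, hpW, fun ε hε => ?_⟩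
  obtain ⟨c, hc0, hcε⟩ := ENNReal.lt_iff_exists_nnreal_btwn.1 (pos_iff_ne_zero.2 hε)
  have hc0' : (0 : ℝ) < c := by exact_mod_cast hc0
  obtain ⟨B, hBo, hBne, hBh, hB⟩ := hW (Real.sqrt (c / 2)) (by positivity)
  have hB0 : volume B ≠ 0 := (hBo.measure_pos volume hBne).ne'
  have hBfin : volume B ≠ ⊤ :=
    (isBounded_iff_forall_norm_le.2 ⟨_, hBh⟩).measure_lt_top.ne
  have hBR : ∀ y ∈ B, ‖y‖ₑ ≤ ENNReal.ofReal (Real.sqrt (c / 2)) := fun y hy => by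
    rw [← ofReal_norm]
    exact ENNReal.ofReal_le_ofReal (hBh y hy)
  have hR : 2 * ENNReal.ofReal (Real.sqrt (c / 2)) ^ 2 ≤ ε := by
    have h2 : (2 : ℝ≥0∞) = ENNReal.ofReal 2 := by simp
    rw [← ENNReal.ofReal_pow (Real.sqrt_nonneg _), Real.sq_sqrt (by positivity), h2,
      ← ENNReal.ofReal_mul (by norm_num), mul_div_cancel₀ _ (by norm_num),
      ENNReal.ofReal_coe_nnreal]
    exact hcε.le
  refine ⟨ε * volume B / 2, by simp [hε, hB0], fun u g hu A hA hAδ => ?_⟩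
  obtain ⟨u', g', hu1, hum, hg1, hgm, hae, hw, hu2, hg2⟩ :=
    hu.exists_global hD.measurableSet hfin
  have key := measure_mul_lintegral_le_of_translates (hU.inter hWo) hu1 hum hg1 hgm hw hA
    hBo.measurableSet hBR fun y hy z hz t ht => hUD (hB y hy z hz t ht)
  have hA' : ∫⁻ z in A, ‖u' z‖ₑ ^ 2 = ∫⁻ z in A, ‖u z‖ₑ ^ 2 := by
    have : u' =ᵐ[volume.restrict A] u :=
      ae_mono (Measure.restrict_mono_set _ ((hA.trans inter_subset_left).trans hUD)) hae
    exact lintegral_congr_ae (this.mono fun z hz => by simp only [hz])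
  rw [hA', hu2, hg2] at key
  refine (ENNReal.mul_le_mul_iff_right hB0 hBfin).1 (key.trans ?_)
  have h3 : 2 * volume A ≤ volume B * ε := by
    calc 2 * volume A ≤ 2 * (ε * volume B / 2) := by gcongr
      _ = volume B * ε := by
        rw [ENNReal.mul_div_cancel (by norm_num) (by norm_num), mul_comm]
  calc _ ≤ volume B * ε * (∫⁻ z in D, ‖u z‖ₑ ^ 2)
        + volume B * (ε * ∫⁻ z in D, ‖g z‖ₑ ^ 2) := by gcongr
    _ = _ := by ring

theorem H1EquiintegrableOn.of_hasLipschitzBoundary {D U : Set E3} (hD : IsOpen D)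
    (hfin : volume D ≠ ⊤) (hU : IsOpen U) (hUD : U ⊆ D) (hbdd : Bornology.IsBounded U)
    (hL : HasLipschitzBoundary U) : H1EquiintegrableOn D U := by
  have h : H1EquiintegrableOn D (U ∩ closure U) := by
    refine hbdd.isCompact_closure.induction_on (p := fun s => H1EquiintegrableOn D (U ∩ s))
      ?_ ?_ ?_ ?_
    · simpa using H1EquiintegrableOn.empty D
    · exact fun s t hst ht => ht.mono (inter_subset_inter_right _ hst)
    · intro s t hs ht
      rw [inter_union_distrib_left]
      exact hs.union ht
    · intro p hp
      obtain ⟨W, hWo, hpW, hW⟩ := exists_H1EquiintegrableOn_inter_nhds hD hfin hU hUD hL hp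
      exact ⟨W, mem_nhdsWithin_of_mem_nhds (hWo.mem_nhds hpW), hW⟩
  rwa [inter_eq_left.2 subset_closure] at h

theorem H1EquiintegrableOn.iUnion {D : Set E3} {N : ℕ} {U : Fin N → Set E3}
    (h : ∀ j, H1EquiintegrableOn D (U j)) : H1EquiintegrableOn D (⋃ j, U j) := by
  have : ∀ s : Finset (Fin N), H1EquiintegrableOn D (⋃ j ∈ s, U j) := by
    intro s
    induction s using Finset.induction_on with
    | empty => simpa using H1EquiintegrableOn.empty D
    | insert a s _ ih =>
      rw [Finset.set_biUnion_insert]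
      exact (h a).union ih
  simpa using this Finset.univ

/-! ### The image of a piecewise linear curve -/

lemma volume_affineSpan_pair (a b : E3) : volume (line[ℝ, a, b] : Set E3) = 0 := by
  refine Measure.addHaar_affineSubspace _ _ fun htop => ?_
  have h1 := (collinear_iff_finrank_le_one (k := ℝ)).1 (collinear_pair ℝ a b)
  have h2 : vectorSpan ℝ {a, b} = (⊤ : Submodule ℝ E3) := by
    rw [← direction_affineSpan, htop, AffineSubspace.direction_top]
  rw [h2, finrank_top, finrank_euclideanSpace_fin] at h1
  omega

theorem IsPiecewiseLinear.isCompact_image_and_volume_eq_zero {σ : ℝ → E3}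
    (h : IsPiecewiseLinear σ) :
    IsCompact (σ '' Icc 0 1) ∧ volume (σ '' Icc 0 1) = 0 := by
  obtain ⟨m, t, hmono, ht0, ht1, hlin⟩ := h
  -- the alternative `s = 0` covers the induction start, where there is no interval yet
  have hcover : ∀ j : Fin (m + 1), ∀ s ∈ Icc 0 (t j),
      s = 0 ∨ ∃ i : Fin m, s ∈ Icc (t i.castSucc) (t i.succ) := by
    intro j
    induction j using Fin.induction with
    | zero => exact fun s hs => Or.inl (le_antisymm (ht0 ▸ hs.2) hs.1)
    | succ i ih =>
      intro s hs
      rcases le_total s (t i.castSucc) with h | h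
      · exact ih s ⟨hs.1, h⟩
      · exact Or.inr ⟨i, h, hs.2⟩
  have himage : σ '' Icc 0 1 = {σ 0} ∪ ⋃ i : Fin m,
      (AffineMap.lineMap (σ (t i.castSucc)) (σ (t i.succ)) : ℝ → E3) '' Icc 0 1 := by
    apply Subset.antisymm
    · rintro _ ⟨s, hs, rfl⟩
      rcases hcover (Fin.last m) s (by rwa [ht1]) with rfl | ⟨i, hi⟩
      · exact Or.inl rfl
      · refine Or.inr (mem_iUnion.2 ⟨i, ?_⟩)
        have hle : t i.castSucc ≤ t i.succ := hi.1.trans hi.2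
        rw [← segment_eq_Icc hle, segment_eq_image_lineMap] at hi
        obtain ⟨r, hr, rfl⟩ := hi
        exact ⟨r, hr, (hlin i r hr).symm⟩
    · refine union_subset ?_ (iUnion_subset fun i => ?_)
      · exact singleton_subset_iff.2 ⟨0, by simp, rfl⟩
      · rintro _ ⟨r, hr, rfl⟩
        rw [← hlin i r hr]
        refine mem_image_of_mem σ ?_
        have hle : t i.castSucc ≤ t i.succ := hmono.monotone (Fin.castSucc_lt_succ).le
        have hmem : AffineMap.lineMap (t i.castSucc) (t i.succ) r
            ∈ Icc (t i.castSucc) (t i.succ) := by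
          rw [← segment_eq_Icc hle, segment_eq_image_lineMap]
          exact mem_image_of_mem _ hr
        exact ⟨(ht0.ge.trans (hmono.monotone (Fin.zero_le _))).trans hmem.1,
          hmem.2.trans ((hmono.monotone (Fin.le_last _)).trans ht1.le)⟩
  rw [himage]
  refine ⟨isCompact_singleton.union (isCompact_iUnion fun i =>
    isCompact_Icc.image AffineMap.lineMap_continuous), ?_⟩
  refine measure_union_null (measure_singleton _) (measure_iUnion_null fun i =>
    measure_mono_null ?_ (volume_affineSpan_pair (σ (t i.castSucc)) (σ (t i.succ))))
  rintro _ ⟨r, -, rfl⟩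
  exact AffineMap.lineMap_mem_affineSpan_pair r _ _

/-! ### Needle sequences on compact sets away from the needle -/

lemma l2Norm_sq {F : Type*} [NormedAddCommGroup F] (S : Set E3) (f : E3 → F) :
    l2Norm S f ^ 2 = (∫⁻ z in S, ‖f z‖ₑ ^ 2).toReal := by
  have h := eLpNorm_nnreal_pow_eq_lintegral (f := f) (μ := volume.restrict S) (p := 2)
    (by norm_num)
  simp only [NNReal.coe_ofNat, ENNReal.rpow_ofNat, ENNReal.coe_ofNat] at h
  rw [l2Norm, ← ENNReal.toReal_pow, h]

lemma lintegral_enorm_sq_ne_top {F : Type*} [NormedAddCommGroup F] {S : Set E3} {f : E3 → F}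
    (hf : MemLp f 2 (volume.restrict S)) : ∫⁻ z in S, ‖f z‖ₑ ^ 2 ≠ ⊤ := by
  have h := eLpNorm_nnreal_pow_eq_lintegral (f := f) (μ := volume.restrict S) (p := 2)
    (by norm_num)
  simp only [NNReal.coe_ofNat, ENNReal.rpow_ofNat, ENNReal.coe_ofNat] at h
  rw [← h]
  exact ENNReal.pow_ne_top hf.2.ne

lemma continuousOn_helmholtzG (k : ℝ) (x : E3) : ContinuousOn (helmholtzG k x) {x}ᶜ := by
  unfold helmholtzG
  refine ContinuousOn.div (Continuous.continuousOn (by fun_prop))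
    (Continuous.continuousOn (by fun_prop)) fun z hz => ?_
  have : ‖z - x‖ ≠ 0 := norm_ne_zero_iff.2 (sub_ne_zero.2 hz)
  exact_mod_cast mul_ne_zero (mul_ne_zero four_ne_zero Real.pi_ne_zero) this

theorem exists_eventually_l2Norm_le {Ω K : Set E3} {k : ℝ} {x : E3} {σ : ℝ → E3}
    {v : ℕ → E3 → ℂ} {g : ℕ → E3 → C3} (hv : ∀ n, IsH1WithGrad Ω (v n) (g n))
    (hconv : ConvergesToG Ω k x σ v g) (hK : IsCompact K) (hKΩ : K ⊆ Ω \ σ '' Icc 0 1)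
    (hxK : x ∉ K) : ∃ M : ℝ, 0 ≤ M ∧ ∀ᶠ n in atTop, l2Norm K (v n) ≤ M := by
  have hG : MemLp (helmholtzG k x) 2 (volume.restrict K) := by
    have hc : ContinuousOn (helmholtzG k x) K :=
      (continuousOn_helmholtzG k x).mono fun z hz hzx => hxK (hzx ▸ hz)
    obtain ⟨C, hC⟩ := hK.exists_bound_of_continuousOn hc
    have : IsFiniteMeasure (volume.restrict K) := ⟨by simpa using hK.measure_lt_top⟩
    exact MemLp.of_bound (hc.aestronglyMeasurable hK.measurableSet) C
      ((ae_restrict_iff' hK.measurableSet).2 (Eventually.of_forall hC))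
  refine ⟨1 + l2Norm K (helmholtzG k x), add_nonneg zero_le_one ENNReal.toReal_nonneg, ?_⟩
  filter_upwards [(hconv K hK hKΩ).eventually_lt_const zero_lt_one] with n hn
  have hvK : MemLp (v n) 2 (volume.restrict K) :=
    (hv n).memLp.mono_measure (Measure.restrict_mono_set _ (hKΩ.trans sdiff_subset))
  have hd : MemLp (fun z => v n z - helmholtzG k x z) 2 (volume.restrict K) := hvK.sub hG
  have h1 : l2Norm K (v n) ≤
      l2Norm K (fun z => v n z - helmholtzG k x z) + l2Norm K (helmholtzG k x) := by
    unfold l2Norm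
    rw [← ENNReal.toReal_add hd.2.ne hG.2.ne]
    refine ENNReal.toReal_mono (ENNReal.add_ne_top.2 ⟨hd.2.ne, hG.2.ne⟩) ?_
    have h2 := eLpNorm_add_le hd.1 hG.1 (p := 2) (by norm_num)
    have h3 : (fun z => v n z - helmholtzG k x z) + helmholtzG k x = v n := by
      ext z
      simp
    rwa [h3] at h2
  have h2 : 0 ≤ l2Norm K (fun z => g n z - gradHelmholtzG k x z) := ENNReal.toReal_nonneg
  linarith

/-! ### The limit of the quotient of the norms -/

/-- With `ε ≤ 1 / 2` the term `ε * X n ^ 2` is absorbed, which leaves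
`X n ^ 2 ≤ 2 * M ^ 2 + 2 * ε * Y n ^ 2`, and `M` is negligible against `Y n`. -/
lemma tendsto_div_atTop_zero_of_sq_le {X Y : ℕ → ℝ} (hX : ∀ n, 0 ≤ X n)
    (hY : Tendsto Y atTop atTop)
    (h : ∀ ε : ℝ, 0 < ε → ∃ M : ℝ, 0 ≤ M ∧
      ∀ᶠ n in atTop, X n ^ 2 ≤ M ^ 2 + ε * (X n ^ 2 + Y n ^ 2)) :
    Tendsto (fun n => X n / Y n) atTop (𝓝 0) := by
  rw [Metric.tendsto_nhds]
  intro η hη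
  obtain ⟨M, hM, hXM⟩ := h (min (1 / 2) (η ^ 2 / 8)) (by positivity)
  filter_upwards [hXM, hY.eventually_ge_atTop 1, hY.eventually_ge_atTop (3 * M / η)]
    with n h1 h2 h3
  have hYpos : 0 < Y n := by linarith
  rw [Real.dist_0_eq_abs, abs_of_nonneg (div_nonneg (hX n) hYpos.le), div_lt_iff₀ hYpos]
  refine lt_of_pow_lt_pow_left₀ 2 (by positivity) ?_
  have h4 : 3 * M ≤ Y n * η := (div_le_iff₀ hη).1 h3
  have h5 : (3 * M) ^ 2 ≤ (Y n * η) ^ 2 := pow_le_pow_left₀ (by positivity) h4 2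
  have h6 : min (1 / 2) (η ^ 2 / 8) * X n ^ 2 ≤ 1 / 2 * X n ^ 2 :=
    mul_le_mul_of_nonneg_right (min_le_left _ _) (sq_nonneg _)
  have h7 : min (1 / 2) (η ^ 2 / 8) * Y n ^ 2 ≤ η ^ 2 / 8 * Y n ^ 2 :=
    mul_le_mul_of_nonneg_right (min_le_right _ _) (sq_nonneg _)
  have h8 : 0 < η ^ 2 * Y n ^ 2 := by positivity
  nlinarith

theorem tendsto_l2Norm_div_of_equiintegrable {Ω D : Set E3} (hD : IsOpen D)
    (hfin : volume D ≠ ⊤) (hDΩ : D ⊆ Ω) (hequi : H1EquiintegrableOn D D) {k : ℝ} {x : E3}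
    {σ : ℝ → E3} (hσ : IsPiecewiseLinear σ) (hx : σ 1 = x) {v : ℕ → E3 → ℂ} {g : ℕ → E3 → C3}
    (hv : ∀ n, IsH1WithGrad Ω (v n) (g n)) (hconv : ConvergesToG Ω k x σ v g)
    (hlim : Tendsto (fun n => l2Norm D (g n)) atTop atTop) :
    Tendsto (fun n => l2Norm D (v n) / l2Norm D (g n)) atTop (𝓝 0) := by
  obtain ⟨hσc, hσ0⟩ := hσ.isCompact_image_and_volume_eq_zero
  have hxσ : x ∈ σ '' Icc 0 1 := ⟨1, by simp, hx⟩
  refine tendsto_div_atTop_zero_of_sq_le (fun n => ENNReal.toReal_nonneg) hlim fun ε hε => ?_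
  obtain ⟨δ, hδ0, hδ⟩ := hequi (ENNReal.ofReal ε) (by simpa using hε)
  -- as the curve is a null set, a compact set avoiding it fills `D` up to measure `δ`
  obtain ⟨K, hKs, hK, hKδ⟩ :=
    (hD.measurableSet.diff hσc.measurableSet).exists_isCompact_sdiff_lt
      (measure_ne_top_of_subset sdiff_subset hfin) hδ0
  obtain ⟨M, hM, hvM⟩ := exists_eventually_l2Norm_le hv hconv hK
    (hKs.trans (sdiff_subset_sdiff_left hDΩ)) fun hxK => (hKs hxK).2 hxσ
  refine ⟨M, hM, hvM.mono fun n hn => ?_⟩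
  have hvD := (hv n).mono hDΩ
  have hKD : K ⊆ D := hKs.trans sdiff_subset
  have hsmall : volume (D \ K) ≤ δ := by
    have hsub : D \ K ⊆ ((D \ σ '' Icc 0 1) \ K) ∪ σ '' Icc 0 1 := fun z hz => by
      by_cases hzσ : z ∈ σ '' Icc 0 1
      · exact Or.inr hzσ
      · exact Or.inl ⟨⟨hz.1, hzσ⟩, hz.2⟩
    calc volume (D \ K) ≤ volume ((D \ σ '' Icc 0 1) \ K) + volume (σ '' Icc 0 1) :=
          (measure_mono hsub).trans (measure_union_le _ _)
      _ ≤ δ := by rw [hσ0, add_zero]; exact hKδ.le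
  have hsplit : ∫⁻ z in D, ‖v n z‖ₑ ^ 2 ≤ (∫⁻ z in K, ‖v n z‖ₑ ^ 2)
      + ENNReal.ofReal ε * ((∫⁻ z in D, ‖v n z‖ₑ ^ 2) + ∫⁻ z in D, ‖g n z‖ₑ ^ 2) := by
    calc ∫⁻ z in D, ‖v n z‖ₑ ^ 2
        ≤ (∫⁻ z in K, ‖v n z‖ₑ ^ 2) + ∫⁻ z in D \ K, ‖v n z‖ₑ ^ 2 := by
          conv_lhs => rw [← union_sdiff_cancel hKD]
          exact lintegral_union_le _ _ _
      _ ≤ _ := by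
          gcongr
          exact hδ _ _ hvD _ sdiff_subset hsmall
  have hfv := lintegral_enorm_sq_ne_top hvD.memLp
  have hfg := lintegral_enorm_sq_ne_top hvD.memLp_grad
  have hfK : ∫⁻ z in K, ‖v n z‖ₑ ^ 2 ≠ ⊤ := ne_top_of_le_ne_top hfv (lintegral_mono_set hKD)
  have hfsum := ENNReal.mul_ne_top (ENNReal.ofReal_ne_top (r := ε))
    (ENNReal.add_ne_top.2 ⟨hfv, hfg⟩)
  have hreal := ENNReal.toReal_mono (ENNReal.add_ne_top.2 ⟨hfK, hfsum⟩) hsplit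
  rw [ENNReal.toReal_add hfK hfsum, ENNReal.toReal_mul, ENNReal.toReal_add hfv hfg,
    ENNReal.toReal_ofReal hε.le, ← l2Norm_sq, ← l2Norm_sq, ← l2Norm_sq] at hreal
  have hKM : l2Norm K (v n) ^ 2 ≤ M ^ 2 := pow_le_pow_left₀ ENNReal.toReal_nonneg hn 2
  linarith

theorem theorem1p3 (Ω : Set E3) (hΩ_open : IsOpen Ω) (hΩ_conn : IsConnected Ω)
    (hΩ_bdd : Bornology.IsBounded Ω) (hΩ_lip : HasLipschitzBoundary Ω)
    (k : ℝ) (hk : 0 ≤ k)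
    (D : Set E3) (hD_open : IsOpen D) (hD_ne : D.Nonempty) (hDΩ : closure D ⊆ Ω)
    (N : ℕ) (Dj : Fin N → Set E3) (hD_union : D = ⋃ j, Dj j)
    (hDj_comp : ∀ j, ∃ z ∈ D, Dj j = connectedComponentIn D z)
    (hDj_lip : ∀ j, HasLipschitzBoundary (Dj j))
    (hDj_disj : ∀ j l, j ≠ l → Disjoint (closure (Dj j)) (closure (Dj l)))
    (x : E3) (hx : x ∈ Ω) (σ : ℝ → E3) (hσ : IsNeedle Ω x σ) :
    -- the result for needle sequences
    (∀ (v : ℕ → E3 → ℂ) (g : ℕ → E3 → C3), IsNeedleSequence Ω k x σ v g →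
      Tendsto (fun n => l2Norm D (g n)) atTop atTop →
      Tendsto (fun n => l2Norm D (v n) / l2Norm D (g n)) atTop (𝓝 0)) ∧
    -- the same for sequences in `H¹(Ω)` that need not solve the Helmholtz equation
    (∀ (v : ℕ → E3 → ℂ) (g : ℕ → E3 → C3), (∀ n, IsH1WithGrad Ω (v n) (g n)) →
      ConvergesToG Ω k x σ v g →
      Tendsto (fun n => l2Norm D (g n)) atTop atTop →
      Tendsto (fun n => l2Norm D (v n) / l2Norm D (g n)) atTop (𝓝 0)) := by
  have hΩD : D ⊆ Ω := subset_closure.trans hDΩ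
  have hfin : volume D ≠ ⊤ := (hΩ_bdd.subset hΩD).measure_lt_top.ne
  have hDjo : ∀ j, IsOpen (Dj j) := fun j => by
    obtain ⟨z, -, hz⟩ := hDj_comp j
    rw [hz]
    exact hD_open.connectedComponentIn
  have hDjD : ∀ j, Dj j ⊆ D := fun j => hD_union ▸ subset_iUnion Dj j
  have hequi : H1EquiintegrableOn D D := by
    have h := H1EquiintegrableOn.iUnion fun j =>
      H1EquiintegrableOn.of_hasLipschitzBoundary hD_open hfin (hDjo j) (hDjD j)
        (hΩ_bdd.subset ((hDjD j).trans hΩD)) (hDj_lip j)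
    rwa [← hD_union] at h
  have main : ∀ (v : ℕ → E3 → ℂ) (g : ℕ → E3 → C3), (∀ n, IsH1WithGrad Ω (v n) (g n)) →
      ConvergesToG Ω k x σ v g →
      Tendsto (fun n => l2Norm D (g n)) atTop atTop →
      Tendsto (fun n => l2Norm D (v n) / l2Norm D (g n)) atTop (𝓝 0) := fun v g hv hconv =>
    tendsto_l2Norm_div_of_equiintegrable hD_open hfin hΩD hequi hσ.piecewiseLinear hσ.tip hv hconv
  exact ⟨fun v g hvg => main v g hvg.memH1 hvg.converges, main⟩
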